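/- For a real random variable $X$ with density $f$, let $h(X)=-\int_{\mathbb R} f\log f\,dx\in[-\infty,\infty]$ be its differential entropy (natural logarithm), where the integral is said to exist if its positive and negative parts are not both infinite; set $h(X)=-\infty$ if the integral does not exist or if $X$ has no density with respect to Lebesgue measure. Say that $h(X)$ is finite if $-\infty<h(X)<\infty$. Let $\mathcal C_{\rm BC}$ (the Bobkov–Chistyakov class) be the class of real random variables $X$ such that $h(X)$ is finite and $h(X+Y)=\infty$ for every random variable $Y$ independent of $X$ with $h(Y)>-\infty$. Theorem. Let $X$ be a real random variable whose differential entropy is finite. Then exactly one of the following two statements holds: 1. $X\in\mathcal C_{\rm BC}$; 2. $h(X+Y)<\infty$ for every random variable $Y\notin\mathcal C_{\rm BC}$, independent of $X$, whose differential entropy $h(Y)$ is finite. (Here "every $Y$ independent of $X$" ranges over all laws of $Y$, with $X$ replaced by a copy on another probability space if needed.) -/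

import Mathlib

open MeasureTheory ProbabilityTheory
open scoped ENNReal

universe u

/-- The density, with respect to Lebesgue measure, of the law of the real random variable `X` on
the probability space `(Ω, P)`; it is a density of that law when the law is absolutely
continuous. -/
noncomputable def lawDensity {Ω : Type*} [MeasurableSpace Ω] (P : Measure Ω) (X : Ω → ℝ) :
    ℝ → ℝ :=
  fun x => ((P.map X).rnDeriv volume x).toReal

/-- The integral of the positive part of `-f log f`, where `f` is the density of `X`. -/
noncomputable def entropyPos {Ω : Type*} [MeasurableSpace Ω] (P : Measure Ω) (X : Ω → ℝ) : ℝ≥0∞ :=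
  ∫⁻ x, ENNReal.ofReal (-(lawDensity P X x * Real.log (lawDensity P X x)))

/-- The integral of the negative part of `-f log f`, where `f` is the density of `X`. -/
noncomputable def entropyNeg {Ω : Type*} [MeasurableSpace Ω] (P : Measure Ω) (X : Ω → ℝ) : ℝ≥0∞ :=
  ∫⁻ x, ENNReal.ofReal (lawDensity P X x * Real.log (lawDensity P X x))

open Classical in
/-- The differential entropy `h(X) = -∫ f log f`, with values in `[-∞, ∞]`. The integral exists if
its positive and negative parts are not both infinite. When it does not exist, or when `X` has no
density, `h(X) = -∞`. -/
noncomputable def diffEntropy {Ω : Type*} [MeasurableSpace Ω] (P : Measure Ω) (X : Ω → ℝ) :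
    EReal :=
  if P.map X ≪ volume ∧ (entropyPos P X ≠ ∞ ∨ entropyNeg P X ≠ ∞) then
    (entropyPos P X : EReal) - (entropyNeg P X : EReal)
  else ⊥

/-- `X` has finite differential entropy: the integral exists and `-∞ < h(X) < ∞`. -/
def FiniteEntropy {Ω : Type*} [MeasurableSpace Ω] (P : Measure Ω) (X : Ω → ℝ) : Prop :=
  ⊥ < diffEntropy P X ∧ diffEntropy P X < ⊤

/-- The class `C_BC`: `h(X)` is finite and `h(X + Y) = ∞` for every random variable `Y` independent
of `X` with `h(Y) > -∞`. The variable `Y` need not live on the space of `X`: as usual, `X` is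
replaced by a copy `X'` with the same law, on a space that also carries `Y`. -/
def InClassBC {Ω : Type u} [MeasurableSpace Ω] (P : Measure Ω) (X : Ω → ℝ) : Prop :=
  FiniteEntropy P X ∧
    ∀ (Ω' : Type u) [MeasurableSpace Ω'] (P' : Measure Ω') [IsProbabilityMeasure P']
      (X' Y : Ω' → ℝ), Measurable X' → Measurable Y → IdentDistrib X' X P' P →
      IndepFun X' Y P' → ⊥ < diffEntropy P' Y → diffEntropy P' (X' + Y) = ⊤

/-! The dichotomy is decided by one number attached to the law μ of X, the ball entropy, i.e. the
expectation of -log μ(B(X,1)). It sees only the spread of μ at unit scale, so finely concentrated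
mass does not affect its finiteness.

If X and Y both have finite ball entropy, then h(X+Y) < ∞: a unit ball around x and one around y add
up into a ball of radius 2 around x+y, so ball masses of the sum are at least products, and
comparing the density with these masses bounds its entropy (`lintegral_mul_negLog_rnDeriv_conv_le`).

If X has infinite ball entropy and h(Y) > -∞, then h(X+Y) = ∞: a bounded, localized piece of the
density of Y gives a part of the density of X+Y dominated by ball masses of μ, hence infinite
positive part (`lintegral_mul_negLog_eq_top`), while Jensen keeps the negative part finite
(`lintegral_ofReal_mul_log_le`).

So a finite-entropy variable outside the class has finite ball entropy, which gives statement 2. A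
uniform variable, whose ball entropy is 0, shows that the two statements exclude each other. -/

/-! ### The positive part of the negative logarithm -/

/-- The positive part of `-log q`, equal to `∞` at `q = 0`. -/
noncomputable def negLog (q : ℝ≥0∞) : ℝ≥0∞ :=
  if q = 0 then ∞ else ENNReal.ofReal (-Real.log q.toReal)

lemma negLog_zero : negLog 0 = ∞ := by simp [negLog]

lemma negLog_of_ne_zero {q : ℝ≥0∞} (hq : q ≠ 0) :
    negLog q = ENNReal.ofReal (-Real.log q.toReal) := by simp [negLog, hq]

lemma negLog_top : negLog ∞ = 0 := by simp [negLog]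

lemma negLog_one : negLog 1 = 0 := by simp [negLog]

lemma negLog_antitone : Antitone negLog := by
  intro a b hab
  rcases eq_or_ne a 0 with rfl | ha
  · simp [negLog_zero]
  rcases eq_or_ne b ∞ with rfl | hb
  · simp [negLog_top]
  have hb0 : b ≠ 0 := fun h => ha (le_zero_iff.1 (h ▸ hab))
  rw [negLog_of_ne_zero ha, negLog_of_ne_zero hb0]
  have ha' : a ≠ ∞ := ne_top_of_le_ne_top hb hab
  exact ENNReal.ofReal_le_ofReal (neg_le_neg
    (Real.log_le_log (ENNReal.toReal_pos ha ha') (ENNReal.toReal_mono hb hab)))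

lemma measurable_negLog : Measurable negLog := negLog_antitone.measurable

lemma negLog_mul_le {a b : ℝ≥0∞} (ha : a ≠ ∞) (hb : b ≠ ∞) :
    negLog (a * b) ≤ negLog a + negLog b := by
  rcases eq_or_ne a 0 with rfl | ha0
  · simp [negLog_zero]
  rcases eq_or_ne b 0 with rfl | hb0
  · simp [negLog_zero]
  rw [negLog_of_ne_zero ha0, negLog_of_ne_zero hb0, negLog_of_ne_zero (mul_ne_zero ha0 hb0),
    ENNReal.toReal_mul, Real.log_mul (ENNReal.toReal_pos ha0 ha).ne'
      (ENNReal.toReal_pos hb0 hb).ne', neg_add]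
  exact ENNReal.ofReal_add_le

/-- The tangent line inequality for `t ↦ t log t`. -/
lemma sub_le_mul_log_sub_mul_log {s t : ℝ} (hs : 0 < s) (ht : 0 ≤ t) :
    t - s ≤ t * Real.log t - t * Real.log s := by
  rcases ht.eq_or_lt with rfl | ht
  · simp [hs.le]
  have h := Real.log_le_sub_one_of_pos (div_pos hs ht)
  rw [Real.log_div hs.ne' ht.ne'] at h
  have h2 := mul_le_mul_of_nonneg_left h ht.le
  have h3 : t * (s / t - 1) = s - t := by field_simp
  rw [h3] at h2
  linarith

lemma mul_negLog_self {t : ℝ≥0∞} (ht : t ≠ ∞) :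
    t * negLog t = ENNReal.ofReal (-(t.toReal * Real.log t.toReal)) := by
  rcases eq_or_ne t 0 with rfl | h0
  · simp
  rw [negLog_of_ne_zero h0, ← mul_neg, ENNReal.ofReal_mul ENNReal.toReal_nonneg,
    ENNReal.ofReal_toReal ht]

/-- Pointwise Gibbs inequality, from the tangent line at q. The reference q need not integrate to 1;
its integral is just an additive cost. -/
lemma mul_negLog_self_le {t q : ℝ≥0∞} (ht : t ≠ ∞) (hq : q ≤ 1) :
    t * negLog t ≤ q + t * negLog q := by
  rcases eq_or_ne t 0 with rfl | ht0
  · simp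
  rcases eq_or_ne q 0 with rfl | hq0
  · simp [negLog_zero, ENNReal.mul_top ht0]
  have hqt : q ≠ ∞ := ne_top_of_le_ne_top ENNReal.one_ne_top hq
  have hqp := ENNReal.toReal_pos hq0 hqt
  have hq1 : q.toReal ≤ 1 := by simpa using ENNReal.toReal_mono ENNReal.one_ne_top hq
  have hlog := Real.log_nonpos hqp.le hq1
  have key := sub_le_mul_log_sub_mul_log hqp (ENNReal.toReal_nonneg (a := t))
  have htp := ENNReal.toReal_nonneg (a := t)
  have e : q + t * negLog q
      = ENNReal.ofReal (q.toReal + t.toReal * -Real.log q.toReal) := by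
    rw [ENNReal.ofReal_add hqp.le (mul_nonneg htp (by linarith)), ENNReal.ofReal_toReal hqt,
      ENNReal.ofReal_mul htp, ENNReal.ofReal_toReal ht, negLog_of_ne_zero hq0]
  rw [e, mul_negLog_self ht]
  exact ENNReal.ofReal_le_ofReal (by linarith)

/-- Replaces the monotonicity that t ↦ -t log t lacks. Compare s with q = t when t ≤ 1, and with q =
1 otherwise. -/
lemma mul_negLog_self_le_of_le {s t : ℝ≥0∞} (hst : s ≤ t) (ht : t ≠ ∞) :
    s * negLog s ≤ t * negLog t + t := by
  have hs : s ≠ ∞ := ne_top_of_le_ne_top ht hst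
  rcases le_total t 1 with h1 | h1
  · refine (mul_negLog_self_le hs h1).trans ?_
    rw [add_comm]
    gcongr
  · refine (mul_negLog_self_le hs le_rfl).trans ?_
    rw [negLog_one, mul_zero, add_zero]
    exact h1.trans le_add_self

/-- Jensen's inequality for the positive part of `t log t`. -/
lemma ofReal_mul_log_lintegral_le {α : Type*} [MeasurableSpace α] (μ : Measure α)
    [IsProbabilityMeasure μ] {g : α → ℝ≥0∞} (hg : Measurable g) (hI : ∫⁻ x, g x ∂μ ≠ ∞) :
    ENNReal.ofReal ((∫⁻ x, g x ∂μ).toReal * Real.log (∫⁻ x, g x ∂μ).toReal)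
      ≤ ∫⁻ x, ENNReal.ofReal ((g x).toReal * Real.log (g x).toReal) ∂μ := by
  set s := (∫⁻ x, g x ∂μ).toReal with hs
  rcases le_total s 1 with h1 | h1
  · rw [ENNReal.ofReal_of_nonpos
      (mul_nonpos_of_nonneg_of_nonpos ENNReal.toReal_nonneg
        (Real.log_nonpos ENNReal.toReal_nonneg h1))]
    exact zero_le
  have hs0 : 0 < s := by linarith
  have hlog := Real.log_nonneg h1
  -- Tangent line at s, with its negative constant moved to the other side; s ≥ 1 makes all
  -- coefficients nonnegative.
  have hpt : ∀ᵐ x ∂μ, ENNReal.ofReal (s * Real.log s) + ENNReal.ofReal (1 + Real.log s) * g x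
      ≤ ENNReal.ofReal ((g x).toReal * Real.log (g x).toReal)
        + ENNReal.ofReal ((1 + Real.log s) * s) := by
    filter_upwards [ae_lt_top hg hI] with x hx
    have ht := ENNReal.toReal_nonneg (a := g x)
    have key := sub_le_mul_log_sub_mul_log hs0 ht
    conv_lhs => rw [← ENNReal.ofReal_toReal hx.ne]
    rw [← ENNReal.ofReal_mul (by linarith), ← ENNReal.ofReal_add (by positivity) (by positivity)]
    refine le_trans (ENNReal.ofReal_le_ofReal ?_) ENNReal.ofReal_add_le
    nlinarith
  have h := lintegral_mono_ae hpt
  rw [lintegral_add_left measurable_const, lintegral_add_right _ measurable_const,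
    lintegral_const_mul _ hg] at h
  simp only [lintegral_const, measure_univ, mul_one] at h
  rw [← ENNReal.ofReal_toReal hI, ← hs, ← ENNReal.ofReal_mul (by linarith)] at h
  exact (ENNReal.add_le_add_iff_right ENNReal.ofReal_ne_top).1 h

/-! ### Ball entropy of a law, and convolutions -/

/-- The expectation of the negative logarithm of the mass of the unit ball around a random point,
a substitute for the entropy of the integer part. -/
noncomputable def ballEntropy (μ : Measure ℝ) : ℝ≥0∞ :=
  ∫⁻ x, negLog (μ (Metric.ball x 1)) ∂μ

lemma measurable_measure_ball (μ : Measure ℝ) [SFinite μ] (r : ℝ) :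
    Measurable fun x => μ (Metric.ball x r) := by
  have h : MeasurableSet {p : ℝ × ℝ | dist p.2 p.1 < r} :=
    (isOpen_lt (by fun_prop) continuous_const).measurableSet
  exact measurable_measure_prodMk_left h

/-- Tonelli and the symmetry of the distance. Thus ball masses are admissible references in
`mul_negLog_self_le`. -/
lemma lintegral_measure_ball (μ : Measure ℝ) [IsProbabilityMeasure μ] (r : ℝ) :
    ∫⁻ x, μ (Metric.ball x r) = ENNReal.ofReal (2 * r) := by
  have h : MeasurableSet {p : ℝ × ℝ | dist p.2 p.1 < r} :=
    (isOpen_lt (by fun_prop) continuous_const).measurableSet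
  calc ∫⁻ x, μ (Metric.ball x r)
      = (volume.prod μ) {p : ℝ × ℝ | dist p.2 p.1 < r} := by rw [Measure.prod_apply h]; rfl
    _ = ∫⁻ y, volume (Metric.ball y r) ∂μ := by
        rw [Measure.prod_apply_symm h]
        refine lintegral_congr fun y => congrArg _ ?_
        ext x
        simp [dist_comm]
    _ = ENNReal.ofReal (2 * r) := by simp [Real.volume_ball]

lemma mul_measure_ball_le_conv (μ ν : Measure ℝ) [IsProbabilityMeasure μ] [IsProbabilityMeasure ν]
    (x y : ℝ) :
    μ (Metric.ball x 1) * ν (Metric.ball y 1) ≤ (μ ∗ ν) (Metric.ball (x + y) 2) := by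
  rw [Measure.conv, Measure.map_apply (by fun_prop) Metric.isOpen_ball.measurableSet,
    ← Measure.prod_prod]
  refine measure_mono fun p hp => ?_
  simp only [Set.mem_prod, Metric.mem_ball, Set.mem_preimage] at hp ⊢
  calc dist (p.1 + p.2) (x + y) ≤ dist p.1 x + dist p.2 y := dist_add_add_le _ _ _ _
    _ < 2 := by linarith [hp.1, hp.2]

/-- The positive part of the entropy of a sum is controlled by the ball entropies. -/
lemma lintegral_mul_negLog_rnDeriv_conv_le (μ ν : Measure ℝ) [IsProbabilityMeasure μ]
    [IsProbabilityMeasure ν] :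
    ∫⁻ w, (μ ∗ ν).rnDeriv volume w * negLog ((μ ∗ ν).rnDeriv volume w)
      ≤ 4 + (ballEntropy μ + ballEntropy ν) := by
  set ρ := μ ∗ ν
  have hq := measurable_measure_ball ρ 2
  have hLq : Measurable fun w => negLog (ρ (Metric.ball w 2)) := measurable_negLog.comp hq
  have hLμ : Measurable fun w => negLog (μ (Metric.ball w 1)) :=
    measurable_negLog.comp (measurable_measure_ball μ 1)
  have hLν : Measurable fun w => negLog (ν (Metric.ball w 1)) :=
    measurable_negLog.comp (measurable_measure_ball ν 1)
  calc ∫⁻ w, ρ.rnDeriv volume w * negLog (ρ.rnDeriv volume w)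
      ≤ ∫⁻ w, (ρ (Metric.ball w 2)
          + ρ.rnDeriv volume w * negLog (ρ (Metric.ball w 2))) := by
        refine lintegral_mono_ae ?_
        filter_upwards [ρ.rnDeriv_lt_top volume] with w hw
        exact mul_negLog_self_le hw.ne prob_le_one
    _ = 4 + ∫⁻ w, ρ.rnDeriv volume w * negLog (ρ (Metric.ball w 2)) := by
        rw [lintegral_add_left hq, lintegral_measure_ball]
        norm_num
    -- The singular part of ρ can only increase the right side, so no absolute continuity is needed.
    _ ≤ 4 + ∫⁻ w, negLog (ρ (Metric.ball w 2)) ∂ρ := by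
        have h := lintegral_withDensity_eq_lintegral_mul volume (ρ.measurable_rnDeriv volume) hLq
        simp only [Pi.mul_apply] at h
        rw [← h]
        gcongr
        exact Measure.withDensity_rnDeriv_le _ _
    _ = 4 + ∫⁻ x, ∫⁻ y, negLog (ρ (Metric.ball (x + y) 2)) ∂ν ∂μ := by
        rw [Measure.lintegral_conv hLq]
    _ ≤ 4 + ∫⁻ x, ∫⁻ y, (negLog (μ (Metric.ball x 1)) + negLog (ν (Metric.ball y 1))) ∂ν ∂μ := by
        gcongr with x y
        exact (negLog_antitone (mul_measure_ball_le_conv μ ν x y)).trans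
          (negLog_mul_le (measure_ne_top _ _) (measure_ne_top _ _))
    _ = 4 + (ballEntropy μ + ballEntropy ν) := by
        simp_rw [lintegral_add_right _ hLν]
        rw [lintegral_add_right _ measurable_const]
        simp [ballEntropy]

lemma measurable_lintegral_sub (μ : Measure ℝ) [SFinite μ] {g : ℝ → ℝ≥0∞} (hg : Measurable g) :
    Measurable fun w => ∫⁻ x, g (w - x) ∂μ :=
  Measurable.lintegral_prod_right' (f := fun p : ℝ × ℝ => g (p.1 - p.2)) (by fun_prop)

lemma conv_withDensity_right (μ : Measure ℝ) [SFinite μ] {g : ℝ → ℝ≥0∞}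
    (hg : Measurable g) [SFinite (volume.withDensity g)] :
    μ ∗ volume.withDensity g = volume.withDensity fun w => ∫⁻ x, g (w - x) ∂μ := by
  refine Measure.ext_of_lintegral _ fun φ hφ => ?_
  have hF := measurable_lintegral_sub μ hg
  rw [Measure.lintegral_conv hφ, lintegral_withDensity_eq_lintegral_mul _ hF hφ]
  calc ∫⁻ x, ∫⁻ y, φ (x + y) ∂(volume.withDensity g) ∂μ
      = ∫⁻ x, (∫⁻ w, g (w - x) * φ w) ∂μ := by
        refine lintegral_congr fun x => ?_
        rw [lintegral_withDensity_eq_lintegral_mul _ hg (by fun_prop),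
          ← lintegral_add_left_eq_self (fun w => g (w - x) * φ w) x]
        simp
    _ = ∫⁻ w, ((fun w => ∫⁻ x, g (w - x) ∂μ) * φ) w := by
        rw [lintegral_lintegral_swap (by fun_prop)]
        refine lintegral_congr fun w => ?_
        rw [Pi.mul_apply, lintegral_mul_const _ (by fun_prop)]

lemma lintegral_lintegral_sub (μ : Measure ℝ) [IsProbabilityMeasure μ] {g : ℝ → ℝ≥0∞}
    (hg : Measurable g) : ∫⁻ w, ∫⁻ x, g (w - x) ∂μ = ∫⁻ y, g y := by
  rw [lintegral_lintegral_swap (by fun_prop)]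
  simp [lintegral_sub_right_eq_self]

lemma exists_setLIntegral_ball_ne_zero {g : ℝ → ℝ≥0∞}
    (h0 : ∫⁻ y, g y ≠ 0) {r : ℝ} (hr : 0 < r) :
    ∃ a, ∫⁻ y in Metric.ball a r, g y ≠ 0 := by
  have h : volume.withDensity g Set.univ ≠ 0 := by simpa using h0
  obtain ⟨a, -, ha⟩ := exists_mem_forall_mem_nhdsWithin_pos_measure h
  refine ⟨a, ?_⟩
  have := ha (Metric.ball a r) (by simpa using Metric.ball_mem_nhds a hr)
  rw [withDensity_apply _ Metric.isOpen_ball.measurableSet] at this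
  exact this.ne'

/-- Adding a variable with a density to one with infinite ball entropy produces a density with
infinite positive part of the entropy. -/
lemma lintegral_mul_negLog_eq_top {μ : Measure ℝ} [IsProbabilityMeasure μ] {g : ℝ → ℝ≥0∞}
    (hg : Measurable g) (h0 : ∫⁻ y, g y ≠ 0) (htop : ∫⁻ y, g y ≠ ∞) (hμ : ballEntropy μ = ∞) :
    ∫⁻ w, (∫⁻ x, g (w - x) ∂μ) * negLog (∫⁻ x, g (w - x) ∂μ) = ∞ := by
  -- Cutting g at height 1 and restricting it to a ball of radius 1/2 yields `gA`, for which each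
  -- averaged value is at most a unit-ball mass of μ.
  have hg1 : Measurable fun y => min (g y) 1 := hg.min measurable_const
  have h1 : ∫⁻ y, min (g y) 1 ≠ 0 := by
    rw [Ne, lintegral_eq_zero_iff hg] at h0
    rw [Ne, lintegral_eq_zero_iff hg1]
    refine fun h => h0 (h.mono fun y hy => ?_)
    simpa using hy
  obtain ⟨a, ha⟩ := exists_setLIntegral_ball_ne_zero h1 (r := 1 / 2) (by norm_num)
  set gA : ℝ → ℝ≥0∞ := (Metric.ball a (1 / 2)).indicator fun y => min (g y) 1 with hgA
  have hball : MeasurableSet (Metric.ball a (1 / 2 : ℝ)) := Metric.isOpen_ball.measurableSet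
  have mgA : Measurable gA := hg1.indicator hball
  have hgAg : ∀ y, gA y ≤ g y := fun y =>
    (Set.indicator_le_self' (fun _ _ => zero_le) y).trans (min_le_left _ _)
  have hIA : ∫⁻ y, gA y ≠ 0 := by rwa [hgA, lintegral_indicator hball]
  have hIA' : ∫⁻ y, gA y ≠ ∞ := ne_top_of_le_ne_top htop (lintegral_mono hgAg)
  set f : ℝ → ℝ≥0∞ := fun w => ∫⁻ x, g (w - x) ∂μ
  set fA : ℝ → ℝ≥0∞ := fun w => ∫⁻ x, gA (w - x) ∂μ
  have mf : Measurable f := measurable_lintegral_sub μ hg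
  have mfA : Measurable fA := measurable_lintegral_sub μ mgA
  have hf : ∫⁻ w, f w ≠ ∞ := by rwa [lintegral_lintegral_sub μ hg]
  have hle : ∫⁻ w, fA w * negLog (fA w) ≤ (∫⁻ w, f w * negLog (f w)) + ∫⁻ w, f w := by
    rw [← lintegral_add_right _ mf]
    refine lintegral_mono_ae ?_
    filter_upwards [ae_lt_top mf hf] with w hw
    exact mul_negLog_self_le_of_le (lintegral_mono fun x => hgAg _) hw.ne
  -- If y and x + y - z both lie in the ball of radius 1/2 around a, then |z - x| < 1.
  have hfA : ∀ x, ∀ y ∈ Metric.ball a (1 / 2 : ℝ), fA (x + y) ≤ μ (Metric.ball x 1) := by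
    intro x y hy
    rw [← lintegral_indicator_one Metric.isOpen_ball.measurableSet]
    refine lintegral_mono fun z => ?_
    by_cases hz : x + y - z ∈ Metric.ball a (1 / 2 : ℝ)
    · have hzx : z ∈ Metric.ball x 1 := by
        rw [Metric.mem_ball, Real.dist_eq, abs_lt] at hy hz ⊢
        constructor <;> linarith [hy.1, hy.2, hz.1, hz.2]
      simp only [hgA]
      rw [Set.indicator_of_mem hz, Set.indicator_of_mem hzx]
      exact min_le_right _ _
    · simp only [hgA]
      rw [Set.indicator_of_notMem hz]
      exact zero_le
  have : IsFiniteMeasure (volume.withDensity gA) := isFiniteMeasure_withDensity hIA'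
  have mL : Measurable fun w => negLog (fA w) := measurable_negLog.comp mfA
  have hinf : ∫⁻ w, fA w * negLog (fA w) = ∞ := by
    have e := lintegral_withDensity_eq_lintegral_mul volume mfA mL
    simp only [Pi.mul_apply] at e
    rw [← e, ← conv_withDensity_right μ mgA, Measure.lintegral_conv mL,
      ← top_le_iff]
    -- The nonzero mass of `gA` carries the infinite ball entropy over to `fA`.
    calc ∞ = ballEntropy μ * ∫⁻ y, gA y := by rw [hμ, ENNReal.top_mul hIA]
      _ = ∫⁻ x, negLog (μ (Metric.ball x 1)) * (∫⁻ y, gA y) ∂μ := by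
        have hm : Measurable fun x => negLog (μ (Metric.ball x 1)) :=
          measurable_negLog.comp (measurable_measure_ball μ 1)
        rw [ballEntropy, lintegral_mul_const _ hm]
      _ ≤ ∫⁻ x, ∫⁻ y, negLog (fA (x + y)) ∂(volume.withDensity gA) ∂μ := by
        refine lintegral_mono fun x => ?_
        have hm : Measurable fun y => negLog (fA (x + y)) := mL.comp (measurable_const_add x)
        rw [lintegral_withDensity_eq_lintegral_mul _ mgA hm, mul_comm,
          ← lintegral_mul_const _ mgA]
        refine lintegral_mono fun y => ?_
        rw [Pi.mul_apply]
        by_cases hy : y ∈ Metric.ball a (1 / 2 : ℝ)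
        · gcongr
          exact negLog_antitone (hfA x y hy)
        · have hy0 : gA y = 0 := Set.indicator_of_notMem hy _
          simp [hy0]
  rw [hinf, top_le_iff, ENNReal.add_eq_top] at hle
  exact hle.resolve_right hf

/-- Adding an independent variable does not increase the negative part of the entropy. -/
lemma lintegral_ofReal_mul_log_le (μ : Measure ℝ) [IsProbabilityMeasure μ] {g : ℝ → ℝ≥0∞}
    (hg : Measurable g) (htop : ∫⁻ y, g y ≠ ∞) :
    ∫⁻ w, ENNReal.ofReal ((∫⁻ x, g (w - x) ∂μ).toReal * Real.log (∫⁻ x, g (w - x) ∂μ).toReal)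
      ≤ ∫⁻ y, ENNReal.ofReal ((g y).toReal * Real.log (g y).toReal) := by
  have hφ : Measurable fun y => ENNReal.ofReal ((g y).toReal * Real.log (g y).toReal) := by
    fun_prop
  -- The right side becomes an average over translates, so Jensen applies at each w.
  rw [← lintegral_lintegral_sub μ hφ]
  refine lintegral_mono_ae ?_
  filter_upwards [ae_lt_top (measurable_lintegral_sub μ hg)
    (by rwa [lintegral_lintegral_sub μ hg])] with w hw
  exact ofReal_mul_log_lintegral_le μ (by fun_prop) hw.ne

/-! ### Differential entropy of random variables -/

section RandomVariables

variable {Ω : Type*} [MeasurableSpace Ω] {P : Measure Ω} {X Y : Ω → ℝ}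

lemma entropyPos_eq_lintegral_mul_negLog [IsFiniteMeasure P] :
    entropyPos P X
      = ∫⁻ x, (P.map X).rnDeriv volume x * negLog ((P.map X).rnDeriv volume x) := by
  refine lintegral_congr_ae ?_
  filter_upwards [(P.map X).rnDeriv_lt_top volume] with x hx
  exact (mul_negLog_self hx.ne).symm

lemma diffEntropy_eq_top_iff :
    diffEntropy P X = ⊤ ↔ P.map X ≪ volume ∧ entropyPos P X = ∞ ∧ entropyNeg P X ≠ ∞ := by
  unfold diffEntropy
  split_ifs with h
  · refine ⟨fun e => ?_, fun ⟨_, hp, hn⟩ => ?_⟩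
    · have hp : entropyPos P X = ∞ := by
        by_contra hp
        lift entropyPos P X to NNReal using hp with p
        generalize entropyNeg P X = n at e
        induction n using ENNReal.recTopCoe with
        | top => simp at e
        | coe n => exact EReal.coe_ne_top ((p : ℝ) - n) e
      exact ⟨h.1, hp, h.2.resolve_left (not_not.2 hp)⟩
    · rw [hp]
      lift entropyNeg P X to NNReal using hn with n
      exact EReal.top_sub_coe n
  · simp only [bot_ne_top, false_iff]
    exact fun ⟨ha, _, hn⟩ => h ⟨ha, Or.inr hn⟩

lemma bot_lt_diffEntropy_iff :
    ⊥ < diffEntropy P X ↔ P.map X ≪ volume ∧ entropyNeg P X ≠ ∞ := by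
  unfold diffEntropy
  split_ifs with h
  · refine ⟨fun e => ⟨h.1, fun hn => ?_⟩, fun ⟨_, hn⟩ => ?_⟩
    · rw [hn] at e
      simp at e
    · lift entropyNeg P X to NNReal using hn with n
      generalize entropyPos P X = p
      induction p using ENNReal.recTopCoe with
      | top => exact (EReal.top_sub_coe (n : ℝ)).symm ▸ bot_lt_top
      | coe p => exact EReal.bot_lt_coe ((p : ℝ) - n)
  · simp only [lt_self_iff_false, false_iff]
    exact fun ⟨ha, hn⟩ => h ⟨ha, Or.inr hn⟩

lemma diffEntropy_add_lt_top [IsProbabilityMeasure P] (hX : Measurable X) (hY : Measurable Y)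
    (h : IndepFun X Y P) (hbX : ballEntropy (P.map X) ≠ ∞) (hbY : ballEntropy (P.map Y) ≠ ∞) :
    diffEntropy P (X + Y) < ⊤ := by
  have := Measure.isProbabilityMeasure_map (μ := P) hX.aemeasurable
  have := Measure.isProbabilityMeasure_map (μ := P) hY.aemeasurable
  refine lt_top_iff_ne_top.2 fun e => ?_
  have hp := (diffEntropy_eq_top_iff.1 e).2.1
  rw [entropyPos_eq_lintegral_mul_negLog, h.map_add_eq_map_conv_map hX hY] at hp
  have hle := lintegral_mul_negLog_rnDeriv_conv_le (P.map X) (P.map Y)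
  rw [hp, top_le_iff] at hle
  simp [hbX, hbY] at hle

lemma diffEntropy_add_eq_top [IsProbabilityMeasure P] (hX : Measurable X) (hY : Measurable Y)
    (h : IndepFun X Y P) (hbX : ballEntropy (P.map X) = ∞) (hhY : ⊥ < diffEntropy P Y) :
    diffEntropy P (X + Y) = ⊤ := by
  have := Measure.isProbabilityMeasure_map (μ := P) hX.aemeasurable
  have := Measure.isProbabilityMeasure_map (μ := P) hY.aemeasurable
  obtain ⟨hac, hn⟩ := bot_lt_diffEntropy_iff.1 hhY
  set g := (P.map Y).rnDeriv volume with hgdef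
  have hg : Measurable g := Measure.measurable_rnDeriv _ _
  have hwd : volume.withDensity g = P.map Y := Measure.withDensity_rnDeriv_eq _ _ hac
  have hI : ∫⁻ y, g y = 1 := by
    rw [← setLIntegral_univ, ← withDensity_apply _ MeasurableSet.univ, hwd, measure_univ]
  have : IsFiniteMeasure (volume.withDensity g) := by rw [hwd]; infer_instance
  have hlaw : P.map (X + Y) = volume.withDensity fun w => ∫⁻ x, g (w - x) ∂(P.map X) := by
    rw [h.map_add_eq_map_conv_map hX hY, ← conv_withDensity_right _ hg, hwd]
  have hrn : (P.map (X + Y)).rnDeriv volume =ᵐ[volume] fun w => ∫⁻ x, g (w - x) ∂(P.map X) := by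
    rw [hlaw]
    exact Measure.rnDeriv_withDensity _ (measurable_lintegral_sub _ hg)
  refine diffEntropy_eq_top_iff.2 ⟨?_, ?_, ?_⟩
  · rw [hlaw]
    exact withDensity_absolutelyContinuous _ _
  · rw [entropyPos_eq_lintegral_mul_negLog, ← lintegral_mul_negLog_eq_top hg
      (by rw [hI]; exact one_ne_zero) (by rw [hI]; exact ENNReal.one_ne_top) hbX]
    refine lintegral_congr_ae ?_
    filter_upwards [hrn] with w hw
    rw [hw]
  · refine ne_top_of_le_ne_top hn (le_trans (le_of_eq ?_) (lintegral_ofReal_mul_log_le (P.map X) hg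
      (by rw [hI]; exact ENNReal.one_ne_top)))
    refine lintegral_congr_ae ?_
    filter_upwards [hrn] with w hw
    simp only [lawDensity]
    rw [hw]

end RandomVariables

lemma inClassBC_of_ballEntropy_eq_top {Ω : Type u} [MeasurableSpace Ω] {P : Measure Ω}
    {X : Ω → ℝ} (hfin : FiniteEntropy P X) (hb : ballEntropy (P.map X) = ∞) : InClassBC P X :=
  ⟨hfin, fun _ _ _ _ _ _ hX' hY hid hind hhY =>
    diffEntropy_add_eq_top hX' hY hind (by rwa [hid.map_eq]) hhY⟩

/-! ### Uniform variables and independent copies -/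

/-- The uniform law on `[0, 1]`. -/
noncomputable def unitUniform : Measure ℝ := volume.restrict (Set.Icc 0 1)

instance : IsProbabilityMeasure unitUniform := ⟨by simp [unitUniform]⟩

lemma ballEntropy_unitUniform : ballEntropy unitUniform = 0 := by
  have h : ∀ᵐ x ∂unitUniform, negLog (unitUniform (Metric.ball x 1)) = 0 := by
    -- The open unit ball around one endpoint misses the other; around interior points it covers the
    -- interval.
    have h0 : ∀ᵐ x ∂unitUniform, x ≠ 0 := by
      rw [unitUniform]
      exact ae_restrict_of_ae (Measure.ae_ne volume 0)
    have h1 : ∀ᵐ x ∂unitUniform, x ≠ 1 := by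
      rw [unitUniform]
      exact ae_restrict_of_ae (Measure.ae_ne volume 1)
    have hI : ∀ᵐ x ∂unitUniform, x ∈ Set.Icc (0 : ℝ) 1 := ae_restrict_mem measurableSet_Icc
    filter_upwards [h0, h1, hI] with x hx0 hx1 hx
    have hsub : Set.Icc (0 : ℝ) 1 ⊆ Metric.ball x 1 := by
      intro y hy
      have a0 := lt_of_le_of_ne hx.1 hx0.symm
      have a1 := lt_of_le_of_ne hx.2 hx1
      rw [Metric.mem_ball, Real.dist_eq, abs_lt]
      constructor <;> linarith [hy.1, hy.2]
    have : unitUniform (Metric.ball x 1) = 1 := by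
      rw [unitUniform, Measure.restrict_apply Metric.isOpen_ball.measurableSet,
        Set.inter_eq_right.2 hsub]
      simp
    rw [this, negLog_one]
  rw [ballEntropy, lintegral_congr_ae h, lintegral_zero]

lemma finiteEntropy_of_map_eq_unitUniform {Ω : Type*} [MeasurableSpace Ω] {P : Measure Ω}
    {U : Ω → ℝ} (hU : P.map U = unitUniform) : FiniteEntropy P U := by
  have hrn : ∀ᵐ x, lawDensity P U x * Real.log (lawDensity P U x) = 0 := by
    simp only [lawDensity]
    rw [hU]
    filter_upwards [Measure.rnDeriv_restrict_self volume (measurableSet_Icc (a := (0 : ℝ)) (b := 1))]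
      with x hx
    rw [unitUniform, hx]
    by_cases h : x ∈ Set.Icc (0 : ℝ) 1 <;> simp [h]
  have hpos : entropyPos P U = 0 := by
    rw [entropyPos, lintegral_congr_ae (g := fun _ => 0), lintegral_zero]
    filter_upwards [hrn] with x hx
    simp [hx]
  have hneg : entropyNeg P U = 0 := by
    rw [entropyNeg, lintegral_congr_ae (g := fun _ => 0), lintegral_zero]
    filter_upwards [hrn] with x hx
    simp [hx]
  refine ⟨bot_lt_diffEntropy_iff.2 ⟨?_, by simp [hneg]⟩, lt_top_iff_ne_top.2 fun h => ?_⟩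
  · rw [hU]
    exact Measure.restrict_le_self.absolutelyContinuous
  · simpa [hpos] using (diffEntropy_eq_top_iff.1 h).2.1

/-- Independent random variables with prescribed laws exist in every universe. -/
lemma exists_indepFun_map_eq (μ ν : Measure ℝ) [IsProbabilityMeasure μ] [IsProbabilityMeasure ν] :
    ∃ (Ω : Type u) (_ : MeasurableSpace Ω) (P : Measure Ω) (X Y : Ω → ℝ),
      IsProbabilityMeasure P ∧ Measurable X ∧ Measurable Y ∧ IndepFun X Y P ∧
        P.map X = μ ∧ P.map Y = ν := by
  have := Measure.isProbabilityMeasure_map (μ := μ)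
    (measurable_up (α := ℝ) : Measurable (ULift.up.{u})).aemeasurable
  have := Measure.isProbabilityMeasure_map (μ := ν)
    (measurable_up (α := ℝ) : Measurable (ULift.up.{u})).aemeasurable
  refine ⟨ULift.{u} ℝ × ULift.{u} ℝ, inferInstance, (μ.map ULift.up).prod (ν.map ULift.up),
    fun p => p.1.down, fun p => p.2.down, inferInstance, measurable_down.comp measurable_fst,
    measurable_down.comp measurable_snd, indepFun_prod measurable_down measurable_down, ?_, ?_⟩
  · rw [show (fun p : ULift.{u} ℝ × ULift.{u} ℝ => p.1.down) = ULift.down ∘ Prod.fst from rfl,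
      ← Measure.map_map measurable_down measurable_fst, Measure.map_fst_prod, measure_univ,
      one_smul, Measure.map_map measurable_down measurable_up]
    exact Measure.map_id
  · rw [show (fun p : ULift.{u} ℝ × ULift.{u} ℝ => p.2.down) = ULift.down ∘ Prod.snd from rfl,
      ← Measure.map_map measurable_down measurable_snd, Measure.map_snd_prod, measure_univ,
      one_smul, Measure.map_map measurable_down measurable_up]
    exact Measure.map_id

lemma not_inClassBC_of_map_eq_unitUniform {Ω : Type u} [MeasurableSpace Ω] {P : Measure Ω}
    {U : Ω → ℝ} (hUm : Measurable U) (hU : P.map U = unitUniform) : ¬ InClassBC P U := by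
  rintro ⟨-, h⟩
  obtain ⟨Ω', _, P', U', V, _, hU'm, hVm, hind, hU', hV⟩ :=
    exists_indepFun_map_eq.{u} unitUniform unitUniform
  have htop := h Ω' P' U' V hU'm hVm ⟨hU'm.aemeasurable, hUm.aemeasurable, hU'.trans hU.symm⟩
    hind (finiteEntropy_of_map_eq_unitUniform hV).1
  refine (diffEntropy_add_lt_top hU'm hVm hind ?_ ?_).ne htop
  · simp [hU', ballEntropy_unitUniform]
  · simp [hV, ballEntropy_unitUniform]

theorem theorem1 {Ω : Type u} [MeasurableSpace Ω] (P : Measure Ω) [IsProbabilityMeasure P]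
    (X : Ω → ℝ) (hX : Measurable X) (hfin : FiniteEntropy P X) :
    Xor (InClassBC P X)
      (∀ (Ω' : Type u) [MeasurableSpace Ω'] (P' : Measure Ω') [IsProbabilityMeasure P']
        (X' Y : Ω' → ℝ), Measurable X' → Measurable Y → IdentDistrib X' X P' P →
        IndepFun X' Y P' → ¬ InClassBC P' Y → FiniteEntropy P' Y →
        diffEntropy P' (X' + Y) < ⊤) := by
  by_cases hBC : InClassBC P X
  · refine Or.inl ⟨hBC, fun h => ?_⟩
    -- An independent uniform U would make h(X+U) both infinite and less than ∞.
    have := Measure.isProbabilityMeasure_map (μ := P) hX.aemeasurable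
    obtain ⟨Ω', _, P', X', U, _, hX'm, hUm, hind, hX', hU⟩ :=
      exists_indepFun_map_eq.{u} (P.map X) unitUniform
    have hid : IdentDistrib X' X P' P := ⟨hX'm.aemeasurable, hX.aemeasurable, hX'⟩
    have hUfin := finiteEntropy_of_map_eq_unitUniform hU
    exact (h Ω' P' X' U hX'm hUm hid hind (not_inClassBC_of_map_eq_unitUniform hUm hU) hUfin).ne
      (hBC.2 Ω' P' X' U hX'm hUm hid hind hUfin.1)
  · refine Or.inr ⟨fun Ω' _ P' _ X' Y hX'm hYm hid hind hYBC hYfin => ?_, hBC⟩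
    refine diffEntropy_add_lt_top hX'm hYm hind ?_
      fun hb => hYBC (inClassBC_of_ballEntropy_eq_top hYfin hb)
    rw [hid.map_eq]
    exact fun hb => hBC (inClassBC_of_ballEntropy_eq_top hfin hb)
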